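/- Let $\mathcal H$ be a complex Hilbert space, let $k$ be an integer with $1\le k<\dim\mathcal H$, and let $\mathbf A=(A_1,\dots,A_m)$ be an $m$-tuple of bounded self-adjoint operators on $\mathcal H$. For an $m$-tuple $\mathbf B=(B_1,\dots,B_m)$ of bounded operators on $\mathcal H$ and an integer $\ell\ge 0$, put $$W_\ell(\mathbf B)=\Big\{\Big(\sum_{j=1}^{\ell}\langle B_1x_j,x_j\rangle,\dots,\sum_{j=1}^{\ell}\langle B_mx_j,x_j\rangle\Big):\{x_1,\dots,x_\ell\}\subseteq\mathcal H\text{ orthonormal}\Big\}\subseteq\mathbb C^m,$$ so that $W_0(\mathbf B)=\{0\}$, and let $$W_{\rm ess}(\mathbf A)=\bigcap\big\{{\bf cl}\,W_1(\mathbf A+\mathbf K):\mathbf K=(K_1,\dots,K_m)\text{ with every }K_j\text{ a compact operator on }\mathcal H\big\}.$$ For a set $S\subseteq\mathbb C^m$ write $nS=\{n\xi:\xi\in S\}$ for integers $n\ge1$, and $0S=\{0\}$ (also when $S=\emptyset$). Sums of sets are Minkowski sums, ${\bf cl}$ is the closure in $\mathbb C^m$ and ${\bf conv}$ is the real convex hull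 in $\mathbb C^m$. Then $${\bf cl}\,({\bf conv}\,W_k(\mathbf A))={\bf conv}\,({\bf cl}\,W_k(\mathbf A))={\bf conv}\bigcup_{0\le\ell\le k}\big(W_\ell(\mathbf A)+(k-\ell)W_{\rm ess}(\mathbf A)\big).$$ Consequently, ${\bf conv}\,W_k(\mathbf A)$ is closed if and only if $$W_\ell(\mathbf A)+(k-\ell)W_{\rm ess}(\mathbf A)\subseteq{\bf conv}\,W_k(\mathbf A)\qquad\text{for }\ell=0,\dots,k-1.$$ -/

import Mathlib

open scoped Pointwise

noncomputable section

namespace JointRange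

variable {H : Type*} [NormedAddCommGroup H] [InnerProductSpace ℂ H] {m : ℕ}

/-- The joint `k`-numerical range `W_k(A) ⊆ ℂ^m` of an `m`-tuple of bounded operators: the set of
`(∑ j, ⟨A_1 x_j, x_j⟩, …, ∑ j, ⟨A_m x_j, x_j⟩)` over orthonormal `x_1, …, x_k`. Mathlib's inner
product is linear in the second variable, hence the order of the arguments. For `k = 0` the sums
are empty and the set is `{0}`. -/
def numRange (k : ℕ) (A : Fin m → H →L[ℂ] H) : Set (Fin m → ℂ) :=
  {a | ∃ x : Fin k → H, Orthonormal ℂ x ∧ ∀ i, a i = ∑ j, inner ℂ (x j) (A i (x j))}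

/-- The joint essential numerical range: the intersection of `cl W_1(A + K)` over all `m`-tuples
`K` of compact operators. -/
def essNumRange (A : Fin m → H →L[ℂ] H) : Set (Fin m → ℂ) :=
  ⋂ K ∈ {K : Fin m → H →L[ℂ] H | ∀ i, IsCompactOperator (K i)}, closure (numRange 1 (A + K))

/-- The dilate `n S = {n ξ : ξ ∈ S}`, with the convention `0 S = {0}` (which matters only for
`S = ∅`). -/
def dilate (n : ℕ) (S : Set (Fin m → ℂ)) : Set (Fin m → ℂ) :=
  if n = 0 then {0} else (fun ξ => (n : ℂ) • ξ) '' S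

theorem numRange_zero (A : Fin m → H →L[ℂ] H) : numRange 0 A = {0} := by
  ext a
  simp only [numRange, Set.mem_ofPred_eq, Set.mem_singleton_iff, Finset.univ_eq_empty,
    Finset.sum_empty, funext_iff, Pi.zero_apply]
  exact ⟨fun ⟨_, _, h⟩ => h,
    fun h => ⟨fun j => j.elim0, ⟨fun j => j.elim0, fun j => j.elim0⟩, h⟩⟩

end JointRange

end

namespace JointRange

open Filter Topology

/-! Since `numRange k A` is bounded in a finite-dimensional space, closure and convex hull commute
(Carathéodory). The rest is two inclusions.

Limits (`closure_numRange_subset`): along an ultrafilter, orthonormal `k`-tuples have weak limits,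
which a unitary of `ℂᵏ` makes mutually orthogonal without changing the sums. A unit vector with weak
limit `y` leaves a weakly null remainder of squared norm tending to `1 - ‖y‖ ^ 2`. So its value
tends to a convex combination of the value at `y / ‖y‖` and a point of the essential range
(`exists_weak_limit_value`). Expanding the sum of these combinations yields terms with `ℓ` genuine
vectors and `k - ℓ` essential points.

Conversely (`numRange_add_smul_subset`), an essential point is, up to closed convex hull, a value at
a unit vector orthogonal to any given finite-dimensional subspace. Orthonormal `ℓ`-tuples can thus
be extended one vector at a time. -/

/-! ### Compactness of convex hulls in finite dimension. -/

/-- Carathéodory bounds the number of points needed, so the hull is a finite union of continuous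
images of compact sets. -/
theorem isCompact_convexHull {E : Type*} [NormedAddCommGroup E] [NormedSpace ℝ E]
    [FiniteDimensional ℝ E] {s : Set E} (hs : IsCompact s) : IsCompact (convexHull ℝ s) := by
  have key : convexHull ℝ s = ⋃ n ∈ Set.Iic (Module.finrank ℝ E + 1),
      (fun p : (Fin n → ℝ) × (Fin n → E) => ∑ i, p.1 i • p.2 i) ''
        (stdSimplex ℝ (Fin n) ×ˢ Set.univ.pi fun _ => s) := by
    apply Set.Subset.antisymm
    · intro x hx
      obtain ⟨ι, _, z, w, hz, hind, hw, hsum, rfl⟩ := eq_pos_convex_span_of_mem_convexHull hx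
      let e := Fintype.equivFin ι
      simp only [Set.mem_iUnion]
      refine ⟨Fintype.card ι, ?_, (w ∘ e.symm, z ∘ e.symm),
        ⟨⟨fun i => (hw _).le, ?_⟩, fun i _ => ?_⟩, ?_⟩
      · exact hind.card_le_finrank_succ.trans (Nat.succ_le_succ (Submodule.finrank_le _))
      · exact (e.symm.sum_comp w).trans hsum
      · exact hz ⟨_, rfl⟩
      · exact e.symm.sum_comp fun i => w i • z i
    · simp only [Set.iUnion_subset_iff]
      rintro n - _ ⟨⟨w, z⟩, ⟨⟨hw, hsum⟩, hz⟩, rfl⟩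
      exact (convex_convexHull ℝ s).sum_mem (fun i _ => hw i) hsum
        fun i _ => subset_convexHull ℝ s (hz i trivial)
  rw [key]
  refine (Set.finite_Iic _).isCompact_biUnion fun n _ => ?_
  refine ((isCompact_stdSimplex ℝ (Fin n)).prod (isCompact_univ_pi fun _ => hs)).image ?_
  fun_prop

theorem exists_tendsto_of_isCompact {α X : Type*} [TopologicalSpace X] (U : Ultrafilter α)
    {s : Set X} (hs : IsCompact s) {f : α → X} (hf : ∀ n, f n ∈ s) :
    ∃ y, Tendsto f U (𝓝 y) := by
  obtain ⟨y, -, hy⟩ := hs.ultrafilter_le_nhds' (U.map f)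
    (Ultrafilter.mem_map.2 (Filter.Eventually.of_forall hf))
  exact ⟨y, hy⟩

variable {H : Type*} [NormedAddCommGroup H] [InnerProductSpace ℂ H] {m : ℕ}

theorem norm_inner_apply_le (T : H →L[ℂ] H) (x : H) : ‖inner ℂ x (T x)‖ ≤ ‖T‖ * ‖x‖ ^ 2 := by
  calc ‖inner ℂ x (T x)‖ ≤ ‖x‖ * ‖T x‖ := norm_inner_le_norm _ _
    _ ≤ ‖x‖ * (‖T‖ * ‖x‖) := by gcongr; exact T.le_opNorm x
    _ = _ := by ring

theorem isBounded_numRange (k : ℕ) (A : Fin m → H →L[ℂ] H) :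
    Bornology.IsBounded (numRange k A) := by
  refine (Metric.isBounded_closedBall (x := (0 : Fin m → ℂ)) (r := k * ∑ i, ‖A i‖)).subset ?_
  rintro a ⟨x, hx, ha⟩
  rw [mem_closedBall_zero_iff, pi_norm_le_iff_of_nonneg (by positivity)]
  intro i
  rw [ha i]
  calc ‖∑ j, inner ℂ (x j) (A i (x j))‖ ≤ ∑ j : Fin k, ‖A i‖ :=
        norm_sum_le_of_le _ fun j _ => by
          simpa [hx.1 j] using norm_inner_apply_le (A i) (x j)
    _ = k * ‖A i‖ := by simp
    _ ≤ _ := by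
      gcongr
      exact Finset.single_le_sum (f := fun i => ‖A i‖) (fun _ _ => norm_nonneg _) (Finset.mem_univ i)

theorem isCompact_closure_numRange (k : ℕ) (A : Fin m → H →L[ℂ] H) :
    IsCompact (closure (numRange k A)) :=
  (isBounded_numRange k A).isCompact_closure

theorem closure_convexHull_numRange (k : ℕ) (A : Fin m → H →L[ℂ] H) :
    closure (convexHull ℝ (numRange k A)) = convexHull ℝ (closure (numRange k A)) := by
  apply Set.Subset.antisymm
  · exact closure_minimal (convexHull_mono subset_closure)
      (isCompact_convexHull (isCompact_closure_numRange k A)).isClosed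
  · exact convexHull_min (closure_mono (subset_convexHull ℝ _)) (convex_convexHull ℝ _).closure

/-! ### Weak limits of unit vectors and the essential range. -/

theorem exists_weak_limit [CompleteSpace H] {α : Type*} (U : Ultrafilter α) (x : α → H)
    (hx : ∀ n, ‖x n‖ ≤ 1) :
    ∃ y : H, ∀ v, Tendsto (fun n => inner ℂ v (x n)) U (𝓝 (inner ℂ v y)) := by
  let f : α → WeakDual ℂ H := fun n => StrongDual.toWeakDual (InnerProductSpace.toDual ℂ H (x n))
  have hf : ∀ n, f n ∈ WeakDual.toStrongDual ⁻¹' Metric.closedBall (0 : StrongDual ℂ H) 1 := by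
    intro n
    simpa [f] using hx n
  obtain ⟨φ, hφ⟩ := exists_tendsto_of_isCompact U
    (WeakDual.isCompact_closedBall (𝕜 := ℂ) (0 : StrongDual ℂ H) 1) hf
  refine ⟨(InnerProductSpace.toDual ℂ H).symm (WeakDual.toStrongDual φ), fun v => ?_⟩
  have h1 : Tendsto (fun n => f n v) U (𝓝 (φ v)) :=
    ((WeakDual.eval_continuous v).tendsto φ).comp hφ
  have h2 := (Complex.continuous_conj.tendsto _).comp h1
  convert h2 using 2
  · simp [f]
  · rw [← inner_conj_symm, InnerProductSpace.toDual_symm_apply]; rfl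

/-- A compact operator maps weakly null bounded families to norm null ones. -/
theorem tendsto_compact_apply [CompleteSpace H] {α : Type*} (U : Ultrafilter α) {z : α → H} {R : ℝ}
    (hR : ∀ n, ‖z n‖ ≤ R) (hz : ∀ v, Tendsto (fun n => inner ℂ v (z n)) U (𝓝 0))
    {K : H →L[ℂ] H} (hK : IsCompactOperator K) : Tendsto (fun n => K (z n)) U (𝓝 0) := by
  obtain ⟨C, hC, hKC⟩ := IsCompactOperator.image_closedBall_subset_compact
    (f := (K : H →ₗ[ℂ] H)) hK R
  obtain ⟨w, hw⟩ := exists_tendsto_of_isCompact U hC (f := fun n => K (z n))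
    fun n => hKC ⟨z n, by simpa using hR n, rfl⟩
  have : w = 0 := by
    have h1 : Tendsto (fun n => inner ℂ w (K (z n))) U (𝓝 (inner ℂ w w)) :=
      tendsto_const_nhds.inner hw
    have h2 : Tendsto (fun n => inner ℂ w (K (z n))) U (𝓝 0) := by
      simpa only [ContinuousLinearMap.adjoint_inner_left] using hz (K.adjoint w)
    exact inner_self_eq_zero.1 (tendsto_nhds_unique h1 h2)
  rwa [this] at hw

theorem mem_numRange_one {A : Fin m → H →L[ℂ] H} {a : Fin m → ℂ} :
    a ∈ numRange 1 A ↔ ∃ x : H, ‖x‖ = 1 ∧ ∀ i, a i = inner ℂ x (A i x) := by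
  constructor
  · rintro ⟨x, hx, ha⟩
    exact ⟨x 0, hx.1 0, fun i => by simpa using ha i⟩
  · rintro ⟨x, hx, ha⟩
    exact ⟨fun _ => x, ⟨fun _ => hx, fun i j hij => (hij (Subsingleton.elim i j)).elim⟩,
      fun i => by simpa using ha i⟩

/-- The value of `A` at the normalization of `z`. -/
theorem smul_inner_mem_numRange_one (A : Fin m → H →L[ℂ] H) {z : H} (hz : z ≠ 0) :
    (fun i => ((‖z‖ ^ 2 : ℝ) : ℂ)⁻¹ * inner ℂ z (A i z)) ∈ numRange 1 A := by
  refine mem_numRange_one.2 ⟨((‖z‖ : ℂ)⁻¹) • z, norm_smul_inv_norm hz, fun i => ?_⟩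
  simp only [map_smul, inner_smul_left, inner_smul_right, map_inv₀, Complex.conj_ofReal]
  push_cast
  ring

/-- Compact perturbations do not affect the limiting quadratic form along a bounded weakly null
family. -/
theorem mem_essNumRange_of_tendsto [CompleteSpace H] {α : Type*} (U : Ultrafilter α)
    (A : Fin m → H →L[ℂ] H) {z : α → H} {R : ℝ} (hR : ∀ n, ‖z n‖ ≤ R)
    (hz : ∀ v, Tendsto (fun n => inner ℂ v (z n)) U (𝓝 0)) {t : ℝ} (ht : 0 < t)
    (hzt : Tendsto (fun n => ‖z n‖ ^ 2) U (𝓝 t)) {b : Fin m → ℂ}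
    (hb : ∀ i, Tendsto (fun n => inner ℂ (z n) (A i (z n))) U (𝓝 (b i))) :
    (fun i => (t : ℂ)⁻¹ * b i) ∈ essNumRange A := by
  simp only [essNumRange, Set.mem_iInter]
  intro K hK
  have hK : ∀ i, IsCompactOperator (K i) := hK
  refine mem_closure_of_tendsto (b := (U : Filter α))
    (f := fun n i => ((‖z n‖ ^ 2 : ℝ) : ℂ)⁻¹ * inner ℂ (z n) ((A + K) i (z n))) ?_ ?_
  · rw [tendsto_pi_nhds]
    intro i
    have hKz : Tendsto (fun n => inner ℂ (z n) (K i (z n))) U (𝓝 0) := by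
      refine squeeze_zero_norm (a := fun n => R * ‖K i (z n)‖) (fun n => ?_) ?_
      · exact (norm_inner_le_norm _ _).trans (by gcongr; exact hR n)
      · simpa using (tendsto_compact_apply U hR hz (hK i)).norm.const_mul R
    refine Tendsto.mul ?_ ?_
    · exact ((Complex.continuous_ofReal.tendsto t).comp hzt).inv₀ (by exact_mod_cast ht.ne')
    · simpa [inner_add_right] using (hb i).add hKz
  · filter_upwards [hzt.eventually (lt_mem_nhds ht)] with n hn
    refine smul_inner_mem_numRange_one (A + K) fun h => ?_
    simp [h] at hn

theorem exists_weak_limit_value [CompleteSpace H] {α : Type*} (U : Ultrafilter α)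
    (A : Fin m → H →L[ℂ] H) {x : α → H} (hx : ∀ n, ‖x n‖ = 1) {y : H}
    (hy : ∀ v, Tendsto (fun n => inner ℂ v (x n)) U (𝓝 (inner ℂ v y))) :
    ‖y‖ ^ 2 ≤ 1 ∧ ∃ ξ : Fin m → ℂ, (‖y‖ ^ 2 < 1 → ξ ∈ essNumRange A) ∧
      ∀ i, Tendsto (fun n => inner ℂ (x n) (A i (x n))) U
        (𝓝 (inner ℂ y (A i y) + ((1 - ‖y‖ ^ 2 : ℝ) : ℂ) * ξ i)) := by
  set t : ℝ := 1 - ‖y‖ ^ 2 with ht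
  let z : α → H := fun n => x n - y
  have hz : ∀ v, Tendsto (fun n => inner ℂ v (z n)) U (𝓝 0) := by
    intro v
    simpa [z, inner_sub_right] using (hy v).sub_const (inner ℂ v y)
  have hz' : ∀ v, Tendsto (fun n => inner ℂ (z n) v) U (𝓝 0) := by
    intro v
    simpa [Function.comp_def] using (Complex.continuous_conj.tendsto _).comp (hz v)
  have hR : ∀ n, ‖z n‖ ≤ 1 + ‖y‖ := fun n => by
    simpa [hx n] using norm_sub_le (x n) y
  have hzt : Tendsto (fun n => ‖z n‖ ^ 2) U (𝓝 t) := by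
    have h1 : ∀ n, ‖z n‖ ^ 2 = 1 - 2 * (inner ℂ y (x n)).re + ‖y‖ ^ 2 := by
      intro n
      have := norm_sub_sq (𝕜 := ℂ) (x n) y
      rw [hx n, inner_re_symm] at this
      simpa [z] using this
    simp only [h1]
    have h2 := (Complex.continuous_re.tendsto _).comp (hy y)
    have h3 := ((h2.const_mul 2).const_sub 1).add_const (‖y‖ ^ 2)
    have h4 : (inner ℂ y y : ℂ).re = ‖y‖ ^ 2 := by
      simpa using inner_self_eq_norm_sq (𝕜 := ℂ) y
    rw [h4, show 1 - 2 * ‖y‖ ^ 2 + ‖y‖ ^ 2 = t by rw [ht]; ring] at h3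
    exact h3
  have ht0 : 0 ≤ t := ge_of_tendsto' hzt fun n => by positivity
  have hb : ∃ b : Fin m → ℂ, ∀ i, Tendsto (fun n => inner ℂ (z n) (A i (z n))) U (𝓝 (b i)) := by
    have : ∀ i, ∃ b : ℂ, Tendsto (fun n => inner ℂ (z n) (A i (z n))) U (𝓝 b) := by
      intro i
      refine exists_tendsto_of_isCompact U
        (isCompact_closedBall (0 : ℂ) (‖A i‖ * (1 + ‖y‖) ^ 2)) fun n => ?_
      rw [mem_closedBall_zero_iff]
      refine (norm_inner_apply_le _ _).trans ?_
      gcongr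
      exact hR n
    choose b hb using this
    exact ⟨b, hb⟩
  obtain ⟨b, hb⟩ := hb
  refine ⟨by linarith, fun i => (t : ℂ)⁻¹ * b i, fun h => ?_, fun i => ?_⟩
  · exact mem_essNumRange_of_tendsto U A hR hz (by linarith) hzt hb
  -- If `t = 0`, then `z n` tends to `0` in norm, so `b i = 0` and the convention `0⁻¹ = 0` is
  -- harmless.
  · have hbt : (t : ℂ) * ((t : ℂ)⁻¹ * b i) = b i := by
      rcases ht0.eq_or_lt with h0 | h0
      · have : Tendsto (fun n => inner ℂ (z n) (A i (z n))) U (𝓝 0) := by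
          refine squeeze_zero_norm (fun n => norm_inner_apply_le (A i) (z n)) ?_
          simpa [← h0] using hzt.const_mul ‖A i‖
        rw [tendsto_nhds_unique (hb i) this]; simp
      · have : (t : ℂ) ≠ 0 := by exact_mod_cast h0.ne'
        field_simp
    rw [hbt]
    have h1 : ∀ n, inner ℂ (x n) (A i (x n)) = inner ℂ y (A i y) +
        (inner ℂ (z n) (A i y) + inner ℂ ((A i).adjoint y) (z n) + inner ℂ (z n) (A i (z n))) := by
      intro n
      simp only [z, map_sub, inner_sub_left, inner_sub_right,
        ContinuousLinearMap.adjoint_inner_left]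
      ring
    simp only [h1]
    simpa using (((hz' (A i y)).add (hz ((A i).adjoint y))).add (hb i)).const_add
      (inner ℂ y (A i y))

/-! ### Unitary rotation of `k`-tuples. -/

/-- The operator `ℂᵏ → H` with prescribed values at the standard basis. -/
noncomputable def synthesis {k : ℕ} (x : Fin k → H) : EuclideanSpace ℂ (Fin k) →L[ℂ] H :=
  ∑ j, (EuclideanSpace.proj j : EuclideanSpace ℂ (Fin k) →L[ℂ] ℂ).smulRight (x j)

theorem synthesis_apply {k : ℕ} (x : Fin k → H) (c : EuclideanSpace ℂ (Fin k)) :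
    synthesis x c = ∑ j, c j • x j := by
  simp [synthesis]

theorem synthesis_basisFun {k : ℕ} (x : Fin k → H) (j : Fin k) :
    synthesis x (EuclideanSpace.basisFun (Fin k) ℂ j) = x j := by
  simp [synthesis_apply, ite_smul]

theorem inner_synthesis {k : ℕ} {x : Fin k → H} (hx : Orthonormal ℂ x)
    (c d : EuclideanSpace ℂ (Fin k)) : inner ℂ (synthesis x c) (synthesis x d) = inner ℂ c d := by
  rw [synthesis_apply, synthesis_apply, hx.inner_sum]
  simp [PiLp.inner_apply, mul_comm]

theorem norm_synthesis {k : ℕ} {x : Fin k → H} (hx : Orthonormal ℂ x)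
    (c : EuclideanSpace ℂ (Fin k)) : ‖synthesis x c‖ = ‖c‖ := by
  rw [norm_eq_sqrt_re_inner (𝕜 := ℂ), inner_synthesis hx, ← norm_eq_sqrt_re_inner]

/-- Both sides are the trace of `S* T S` with `S = synthesis x`, computed in two orthonormal bases.
-/
theorem sum_inner_synthesis [CompleteSpace H] {k : ℕ} (x : Fin k → H) (T : H →L[ℂ] H)
    (b : OrthonormalBasis (Fin k) ℂ (EuclideanSpace ℂ (Fin k))) :
    ∑ j, inner ℂ (synthesis x (b j)) (T (synthesis x (b j))) = ∑ j, inner ℂ (x j) (T (x j)) := by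
  have h : ∀ b : OrthonormalBasis (Fin k) ℂ (EuclideanSpace ℂ (Fin k)),
      ∑ j, inner ℂ (synthesis x (b j)) (T (synthesis x (b j))) =
        LinearMap.trace ℂ _ (((synthesis x).adjoint ∘L T ∘L synthesis x :
          EuclideanSpace ℂ (Fin k) →L[ℂ] EuclideanSpace ℂ (Fin k)) :
          EuclideanSpace ℂ (Fin k) →ₗ[ℂ] EuclideanSpace ℂ (Fin k)) := by
    intro b
    rw [LinearMap.trace_eq_sum_inner _ b]
    simp [ContinuousLinearMap.adjoint_inner_right]
  rw [h b, ← h (EuclideanSpace.basisFun (Fin k) ℂ)]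
  simp only [synthesis_basisFun]

/-- An eigenbasis of the Gram operator `S* S`, with `S = synthesis y`, works. -/
theorem exists_orthonormalBasis_orthogonal [CompleteSpace H] {k : ℕ} (y : Fin k → H) :
    ∃ b : OrthonormalBasis (Fin k) ℂ (EuclideanSpace ℂ (Fin k)),
      ∀ i j, i ≠ j → inner ℂ (synthesis y (b i)) (synthesis y (b j)) = 0 := by
  let T : EuclideanSpace ℂ (Fin k) →L[ℂ] EuclideanSpace ℂ (Fin k) :=
    (synthesis y).adjoint ∘L synthesis y
  have hT : (T : EuclideanSpace ℂ (Fin k) →ₗ[ℂ] EuclideanSpace ℂ (Fin k)).IsSymmetric := by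
    intro c d
    simp [T, ContinuousLinearMap.adjoint_inner_left, ContinuousLinearMap.adjoint_inner_right]
  have hn : Module.finrank ℂ (EuclideanSpace ℂ (Fin k)) = k := by simp
  refine ⟨hT.eigenvectorBasis hn, fun i j hij => ?_⟩
  have h := hT.apply_eigenvectorBasis hn j
  rw [← ContinuousLinearMap.adjoint_inner_right]
  change inner ℂ _ ((T : EuclideanSpace ℂ (Fin k) →ₗ[ℂ] EuclideanSpace ℂ (Fin k)) _) = 0
  rw [h, inner_smul_right, (hT.eigenvectorBasis hn).orthonormal.2 hij, mul_zero]

theorem tendsto_inner_synthesis {k : ℕ} {α : Type*} {l : Filter α} {x : α → Fin k → H}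
    {y : Fin k → H} (hy : ∀ j v, Tendsto (fun n => inner ℂ v (x n j)) l (𝓝 (inner ℂ v (y j))))
    (c : EuclideanSpace ℂ (Fin k)) (v : H) :
    Tendsto (fun n => inner ℂ v (synthesis (x n) c)) l (𝓝 (inner ℂ v (synthesis y c))) := by
  simp only [synthesis_apply, inner_sum, inner_smul_right]
  exact tendsto_finsetSum _ fun j _ => (hy j v).const_mul _

/-! ### Limit points of the `k`-numerical range. -/

theorem sum_inner_mem_numRange {ι : Type*} [Fintype ι] (A : Fin m → H →L[ℂ] H) {u : ι → H}
    (hu : Orthonormal ℂ u) :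
    (fun i => ∑ j, inner ℂ (u j) (A i (u j))) ∈ numRange (Fintype.card ι) A :=
  ⟨u ∘ (Fintype.equivFin ι).symm, hu.comp _ (Fintype.equivFin ι).symm.injective, fun i =>
    ((Fintype.equivFin ι).symm.sum_comp fun j => inner ℂ (u j) (A i (u j))).symm⟩

/-- The union of the sets `W_ℓ(A) + (k - ℓ) W_ess(A)` over `ℓ ≤ k`. -/
def mixedRange (k : ℕ) (A : Fin m → H →L[ℂ] H) : Set (Fin m → ℂ) :=
  ⋃ ℓ ∈ Set.Iic k, (numRange ℓ A + dilate (k - ℓ) (essNumRange A))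

/-- For nonempty `s`, the point is the average over `j ∈ s` of the points `w + s.card • ξ j`, so
convexity of the essential range is not needed. -/
theorem add_sum_mem_convexHull_mixedRange {k ℓ : ℕ} {A : Fin m → H →L[ℂ] H} {w : Fin m → ℂ}
    (hw : w ∈ numRange ℓ A) {ι : Type*} (s : Finset ι) (hs : ℓ + s.card = k)
    {ξ : ι → Fin m → ℂ} (hξ : ∀ j ∈ s, ξ j ∈ essNumRange A) :
    w + ∑ j ∈ s, ξ j ∈ convexHull ℝ (mixedRange k A) := by
  have hk : k - ℓ = s.card := by omega
  rcases s.eq_empty_or_nonempty with rfl | hne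
  · refine subset_convexHull ℝ _ (Set.mem_biUnion (show ℓ ∈ Set.Iic k by simp; omega) ?_)
    exact Set.add_mem_add hw (by simp [dilate, hk])
  · have hc : (s.card : ℝ) ≠ 0 := by exact_mod_cast hne.card_pos.ne'
    have h : ∀ j ∈ s, w + (s.card : ℂ) • ξ j ∈ convexHull ℝ (mixedRange k A) := by
      intro j hj
      refine subset_convexHull ℝ _ (Set.mem_biUnion (show ℓ ∈ Set.Iic k by simp; omega) ?_)
      refine Set.add_mem_add hw ?_
      rw [dilate, hk, if_neg hne.card_pos.ne']
      exact ⟨ξ j, hξ j hj, rfl⟩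
    have := (convex_convexHull ℝ (mixedRange k A)).sum_mem (t := s)
      (w := fun _ => (s.card : ℝ)⁻¹) (fun _ _ => by positivity) (by simp [hc]) h
    convert this using 1
    rw [← Finset.smul_sum, Finset.sum_add_distrib, Finset.sum_const, ← Finset.smul_sum, smul_add,
      ← Nat.cast_smul_eq_nsmul ℝ, smul_smul, inv_mul_cancel₀ hc, one_smul]
    congr 1
    ext i
    have hc' : (s.card : ℂ) ≠ 0 := by exact_mod_cast hc
    simp only [Pi.smul_apply, Complex.real_smul, smul_eq_mul]
    push_cast
    field_simp

theorem closure_numRange_subset [CompleteSpace H] (k : ℕ) (A : Fin m → H →L[ℂ] H) :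
    closure (numRange k A) ⊆ convexHull ℝ (mixedRange k A) := by
  intro a ha
  obtain ⟨s, hs, hsa⟩ := mem_closure_iff_seq_limit.1 ha
  choose x hx hxs using hs
  let U : Ultrafilter ℕ := hyperfilter ℕ
  have hsa : Tendsto s U (𝓝 a) := hsa.mono_left Nat.hyperfilter_le_atTop
  have hwk : ∀ j, ∃ y : H, ∀ v, Tendsto (fun n => inner ℂ v (x n j)) U (𝓝 (inner ℂ v y)) :=
    fun j => exists_weak_limit U _ fun n => ((hx n).1 j).le
  choose y hy using hwk
  obtain ⟨b, hb⟩ := exists_orthonormalBasis_orthogonal y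
  have hval : ∀ j, ‖synthesis y (b j)‖ ^ 2 ≤ 1 ∧ ∃ ξ : Fin m → ℂ,
      (‖synthesis y (b j)‖ ^ 2 < 1 → ξ ∈ essNumRange A) ∧
      ∀ i, Tendsto (fun n => inner ℂ (synthesis (x n) (b j)) (A i (synthesis (x n) (b j)))) U
        (𝓝 (inner ℂ (synthesis y (b j)) (A i (synthesis y (b j))) +
          ((1 - ‖synthesis y (b j)‖ ^ 2 : ℝ) : ℂ) * ξ i)) := by
    refine fun j => exists_weak_limit_value U A (fun n => ?_)
      (tendsto_inner_synthesis hy (b j))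
    rw [norm_synthesis (hx n), b.orthonormal.1 j]
  set y' : Fin k → H := fun j => synthesis y (b j) with hy'
  choose hle ξ hξ hlim using hval
  let ω : Fin k → Fin m → ℂ := fun j i =>
    ((‖y' j‖ ^ 2 : ℝ) : ℂ)⁻¹ * inner ℂ (y' j) (A i (y' j))
  have hω : ∀ j i, ((‖y' j‖ ^ 2 : ℝ) : ℂ) * ω j i = inner ℂ (y' j) (A i (y' j)) := by
    intro j i
    by_cases h : y' j = 0
    · simp [h]
    · have : ((‖y' j‖ ^ 2 : ℝ) : ℂ) ≠ 0 := by
        exact_mod_cast (pow_pos (norm_pos_iff.2 h) 2).ne'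
      simp only [ω]
      field_simp
  have ha' : a = ∑ j, (‖y' j‖ ^ 2 • ω j + (1 - ‖y' j‖ ^ 2) • ξ j) := by
    ext i
    have h1 : Tendsto (fun n => s n i) U (𝓝 (a i)) := (tendsto_pi_nhds.1 hsa) i
    have h2 := tendsto_finsetSum Finset.univ fun j _ => hlim j i
    simp only [sum_inner_synthesis, ← hxs] at h2
    rw [tendsto_nhds_unique h1 h2, Finset.sum_apply]
    refine Finset.sum_congr rfl fun j _ => ?_
    simp only [Pi.add_apply, Pi.smul_apply, Complex.real_smul, hω, y']
  -- Only the endpoints with positive weight are kept: `ω j` is a genuine value when `y' j ≠ 0`, and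
  -- `ξ j` is essential when `‖y' j‖ < 1`. The hull of a Minkowski sum is the sum of the hulls, so
  -- it suffices to treat one choice of endpoint for each `j`.
  let V : Fin k → Set (Fin m → ℂ) := fun j =>
    {v | (y' j ≠ 0 ∧ v = ω j) ∨ (‖y' j‖ ^ 2 < 1 ∧ v = ξ j)}
  have hmem : ∀ j, ‖y' j‖ ^ 2 • ω j + (1 - ‖y' j‖ ^ 2) • ξ j ∈ convexHull ℝ (V j) := by
    intro j
    by_cases h0 : y' j = 0
    · refine subset_convexHull ℝ _ (Or.inr ⟨by simp [h0], by simp [h0]⟩)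
    · rcases (hle j).eq_or_lt with h1 | h1
      · exact subset_convexHull ℝ _ (Or.inl ⟨h0, by simp only [hy'] at h1 ⊢; simp [h1]⟩)
      · exact (convex_convexHull ℝ (V j)) (subset_convexHull ℝ _ (Or.inl ⟨h0, rfl⟩))
          (subset_convexHull ℝ _ (Or.inr ⟨h1, rfl⟩)) (by positivity) (by linarith [hle j])
          (by ring)
  have hsum : a ∈ convexHull ℝ (∑ j, V j) := by
    rw [convexHull_sum, ha']
    exact Set.finsetSum_mem_finsetSum _ _ _ fun j _ => hmem j
  refine convexHull_min ?_ (convex_convexHull ℝ _) hsum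
  intro v hv
  obtain ⟨g, hg, rfl⟩ := (Set.mem_finsetSum _ _ _).1 hv
  classical
  let J : Finset (Fin k) := Finset.univ.filter fun j => y' j ≠ 0 ∧ g j = ω j
  have hJ : ∀ j ∈ Jᶜ, g j ∈ essNumRange A := by
    intro j hj
    rcases hg (Finset.mem_univ j) with h | ⟨h, h'⟩
    · simp only [J, Finset.mem_compl, Finset.mem_filter, Finset.mem_univ, true_and] at hj
      exact (hj h).elim
    · rw [h']
      exact hξ j h
  have hu : Orthonormal ℂ fun j : J => ((‖y' j‖ : ℂ)⁻¹) • y' j := by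
    refine ⟨fun j => norm_smul_inv_norm (Finset.mem_filter.1 j.2).2.1, fun i j hij => ?_⟩
    have h := hb _ _ fun h : (i : Fin k) = j => hij (Subtype.ext h)
    simp [inner_smul_left, inner_smul_right, y', h]
  have hw := sum_inner_mem_numRange A hu
  rw [Fintype.card_coe] at hw
  have hfin := add_sum_mem_convexHull_mixedRange (k := k) hw Jᶜ
    (by rw [Finset.card_add_card_compl, Fintype.card_fin]) hJ
  convert hfin using 1
  rw [← Finset.sum_add_sum_compl J]
  congr 1
  ext i
  rw [Finset.sum_apply, ← Finset.sum_coe_sort J]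
  refine Finset.sum_congr rfl fun j _ => ?_
  rw [(Finset.mem_filter.1 j.2).2.2]
  simp only [ω, map_smul, inner_smul_left, inner_smul_right, map_inv₀, Complex.conj_ofReal]
  push_cast
  ring

/-! ### Essential points as values on orthogonal complements. -/

theorem isCompactOperator_starProjection (F : Submodule ℂ H) [FiniteDimensional ℂ F] :
    IsCompactOperator F.starProjection := by
  have : ProperSpace F := FiniteDimensional.proper ℂ F
  exact (isCompactOperator_of_locallyCompactSpace_dom F.orthogonalProjectionOnto).clm_comp
    F.subtypeL

/-- The joint numerical range of the compression of `A` to `Fᗮ`. -/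
def compressedRange (F : Submodule ℂ H) (A : Fin m → H →L[ℂ] H) : Set (Fin m → ℂ) :=
  {a | ∃ x ∈ Fᗮ, ‖x‖ = 1 ∧ ∀ i, a i = inner ℂ x (A i x)}

theorem essNumRange_subset_compressedRange (F : Submodule ℂ H) [FiniteDimensional ℂ F]
    (hF : Fᗮ ≠ ⊥) (A : Fin m → H →L[ℂ] H) :
    essNumRange A ⊆ closure (convexHull ℝ (compressedRange F A)) := by
  have hval : ∀ x ∈ Fᗮ, x ≠ 0 →
      (fun i => ((‖x‖ ^ 2 : ℝ) : ℂ)⁻¹ * inner ℂ x (A i x)) ∈ compressedRange F A := by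
    intro x hx hx0
    refine ⟨((‖x‖ : ℂ)⁻¹) • x, Fᗮ.smul_mem _ hx, norm_smul_inv_norm hx0, fun i => ?_⟩
    simp only [map_smul, inner_smul_left, inner_smul_right, map_inv₀, Complex.conj_ofReal]
    push_cast
    ring
  obtain ⟨x₀, hx₀, hx₀'⟩ := Submodule.exists_mem_ne_zero_of_ne_bot hF
  obtain ⟨c, hc⟩ : (compressedRange F A).Nonempty := ⟨_, hval x₀ hx₀ hx₀'⟩
  let Q := F.starProjection
  let P := Fᗮ.starProjection
  have hPQ : ∀ x, x = Q x + P x := fun x =>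
    (F.starProjection_add_starProjection_orthogonal x).symm
  -- Chosen so that `A i + K i = P (A i) P + c i Q`. As `c` is itself a value on `Fᗮ`, every value
  -- of `A + K` is a convex combination of values on `Fᗮ`.
  let K : Fin m → H →L[ℂ] H := fun i => P ∘L A i ∘L P - A i + c i • Q
  have hQ : IsCompactOperator Q := isCompactOperator_starProjection F
  have hK : ∀ i, IsCompactOperator (K i) := by
    intro i
    have h : K i = c i • Q - Q ∘L (A i ∘L P) - A i ∘L Q := by
      ext x
      have h1 : P (A i (P x)) = A i (P x) - Q (A i (P x)) := eq_sub_of_add_eq' (hPQ _).symm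
      have h2 : A i x = A i (Q x) + A i (P x) := by rw [← map_add, ← hPQ]
      simp only [K, add_apply, sub_apply,
        ContinuousLinearMap.comp_apply, smul_apply, h1, h2]
      abel
    rw [h]
    exact ((hQ.smul (c i)).sub (hQ.comp_clm (A i ∘L P))).sub (hQ.clm_comp (A i))
  intro ξ hξ
  simp only [essNumRange, Set.mem_iInter] at hξ
  refine closure_mono ?_ (hξ K hK)
  intro a ha
  obtain ⟨x, hx, hax⟩ := mem_numRange_one.1 ha
  have hnorm : 1 = ‖Q x‖ ^ 2 + ‖P x‖ ^ 2 := by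
    have := Submodule.norm_sq_eq_add_norm_sq_starProjection x F
    rwa [hx, one_pow] at this
  have ha' : ∀ i, a i = inner ℂ (P x) (A i (P x)) + ((‖Q x‖ ^ 2 : ℝ) : ℂ) * c i := by
    intro i
    have h1 : inner ℂ x (P (A i (P x))) = inner ℂ (P x) (A i (P x)) :=
      (Submodule.inner_starProjection_left_eq_right Fᗮ _ _).symm
    have h2 : inner ℂ x (Q x) = ((‖Q x‖ ^ 2 : ℝ) : ℂ) := by
      have h3 : Q (Q x) = Q x :=
        Submodule.starProjection_eq_self_iff.2 (Submodule.starProjection_apply_mem F x)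
      rw [← h3, ← Submodule.inner_starProjection_left_eq_right F, h3]
      exact (inner_self_eq_norm_sq_to_K (𝕜 := ℂ) (Q x)).trans (by simp)
    rw [hax i]
    simp only [Pi.add_apply, K, add_apply, sub_apply,
      ContinuousLinearMap.comp_apply, smul_apply,
      inner_add_right, inner_smul_right, inner_sub_right, h1, h2]
    ring
  by_cases hPx : P x = 0
  · have : a = c := by
      ext i
      rw [ha' i]
      rw [hPx] at hnorm ⊢
      have : ‖Q x‖ ^ 2 = 1 := by simpa using hnorm.symm
      simp [this]
    rw [this]
    exact subset_convexHull ℝ _ hc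
  · have hmem := hval (P x) (Submodule.starProjection_apply_mem Fᗮ x) hPx
    have := (convex_convexHull ℝ (compressedRange F A)) (subset_convexHull ℝ _ hmem)
      (subset_convexHull ℝ _ hc) (a := ‖P x‖ ^ 2) (b := ‖Q x‖ ^ 2) (by positivity) (by positivity)
      (by linarith)
    convert this using 1
    ext i
    have hne : ((‖P x‖ ^ 2 : ℝ) : ℂ) ≠ 0 := by
      exact_mod_cast (pow_pos (norm_pos_iff.2 hPx) 2).ne'
    simp only [ha' i, Pi.add_apply, Pi.smul_apply, Complex.real_smul, mul_inv_cancel_left₀ hne]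

/-- Induction on the number of copies of `ξ`: one copy is replaced by the value at a unit vector
orthogonal to the `ℓ`-tuple, and the closed convex target absorbs the passage back to `ξ`. -/
theorem numRange_add_smul_subset (A : Fin m → H →L[ℂ] H) {k : ℕ}
    (hdim : (k : Cardinal) < Module.rank ℂ H) {ξ : Fin m → ℂ} (hξ : ξ ∈ essNumRange A) (n : ℕ) :
    ∀ ℓ, ℓ + n = k → ∀ w ∈ numRange ℓ A,
      w + (n : ℂ) • ξ ∈ closure (convexHull ℝ (numRange k A)) := by
  induction n with
  | zero =>
    rintro ℓ rfl w hw
    simpa using subset_closure (subset_convexHull ℝ _ hw)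
  | succ n ih =>
    rintro ℓ hℓ w ⟨x, hx, hw⟩
    let F := Submodule.span ℂ (Set.range x)
    have : FiniteDimensional ℂ F := FiniteDimensional.span_of_finite ℂ (Set.finite_range x)
    have hF : Fᗮ ≠ ⊥ := by
      rw [Ne, Submodule.orthogonal_eq_bot_iff]
      intro h
      have h1 : Module.rank ℂ F ≤ ℓ := by
        rw [← Module.finrank_eq_rank]
        exact_mod_cast (finrank_range_le_card (R := ℂ) x).trans_eq (Fintype.card_fin ℓ)
      rw [h, rank_top] at h1
      have h2 : (ℓ : Cardinal) ≤ k := by exact_mod_cast (by omega : ℓ ≤ k)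
      exact (h1.trans h2).not_gt hdim
    have hsub : compressedRange F A ⊆
        (fun η => (w + (n : ℂ) • ξ) + η) ⁻¹' closure (convexHull ℝ (numRange k A)) := by
      rintro η ⟨u, hu, hu1, hη⟩
      have : w + η ∈ numRange (ℓ + 1) A := by
        refine ⟨Matrix.vecCons u x, orthonormal_vecCons_iff.2 ⟨hu1, fun i => ?_, hx⟩,
          fun i => ?_⟩
        · exact Submodule.inner_left_of_mem_orthogonal
            (Submodule.subset_span (Set.mem_range_self i)) hu
        · simp [Fin.sum_univ_succ, hw i, hη i, add_comm]
      have := ih (ℓ + 1) (by omega) _ this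
      rwa [add_right_comm] at this
    have hC : Convex ℝ ((fun η => (w + (n : ℂ) • ξ) + η) ⁻¹'
        closure (convexHull ℝ (numRange k A))) :=
      ((convex_convexHull ℝ (numRange k A)).closure).translate_preimage_right _
    have hcl : IsClosed ((fun η => (w + (n : ℂ) • ξ) + η) ⁻¹'
        closure (convexHull ℝ (numRange k A))) :=
      isClosed_closure.preimage (by fun_prop)
    have := closure_minimal (convexHull_min hsub hC) hcl
      (essNumRange_subset_compressedRange F hF A hξ)
    rw [Nat.cast_succ, add_smul, one_smul, ← add_assoc]
    exact this

theorem numRange_add_dilate_subset (A : Fin m → H →L[ℂ] H) {k ℓ : ℕ}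
    (hdim : (k : Cardinal) < Module.rank ℂ H) (hℓ : ℓ ≤ k) :
    numRange ℓ A + dilate (k - ℓ) (essNumRange A) ⊆ closure (convexHull ℝ (numRange k A)) := by
  rintro _ ⟨w, hw, v, hv, rfl⟩
  rw [dilate] at hv
  split_ifs at hv with h
  · obtain rfl : ℓ = k := by omega
    rw [Set.mem_singleton_iff.1 hv]
    simpa using subset_closure (subset_convexHull ℝ _ hw)
  · obtain ⟨ξ, hξ, rfl⟩ := hv
    exact numRange_add_smul_subset A hdim hξ (k - ℓ) ℓ (by omega) w hw

/-! ### The equality of hulls and the closedness criterion. -/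

theorem convexHull_closure_numRange [CompleteSpace H] (A : Fin m → H →L[ℂ] H) {k : ℕ}
    (hdim : (k : Cardinal) < Module.rank ℂ H) :
    convexHull ℝ (closure (numRange k A)) = convexHull ℝ (mixedRange k A) := by
  apply Set.Subset.antisymm
  · exact convexHull_min (closure_numRange_subset k A) (convex_convexHull ℝ _)
  · rw [← closure_convexHull_numRange]
    refine convexHull_min ?_ (convex_convexHull ℝ _).closure
    simp only [mixedRange, Set.iUnion_subset_iff]
    exact fun ℓ hℓ => numRange_add_dilate_subset A hdim hℓ

end JointRange

theorem mainTheorem2 {H : Type*} [NormedAddCommGroup H] [InnerProductSpace ℂ H] [CompleteSpace H]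
    {m : ℕ} (A : Fin m → H →L[ℂ] H) (hA : ∀ i, IsSelfAdjoint (A i))
    (k : ℕ) (hk : 1 ≤ k) (hdim : (k : Cardinal) < Module.rank ℂ H) :
    (closure (convexHull ℝ (JointRange.numRange k A)) =
        convexHull ℝ (closure (JointRange.numRange k A)) ∧
      convexHull ℝ (closure (JointRange.numRange k A)) =
        convexHull ℝ (⋃ ℓ ∈ Set.Iic k,
          (JointRange.numRange ℓ A + JointRange.dilate (k - ℓ) (JointRange.essNumRange A)))) ∧
    (IsClosed (convexHull ℝ (JointRange.numRange k A)) ↔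
      ∀ ℓ < k, JointRange.numRange ℓ A + JointRange.dilate (k - ℓ) (JointRange.essNumRange A) ⊆
        convexHull ℝ (JointRange.numRange k A)) := by
  have hcl := JointRange.closure_convexHull_numRange k A
  have hmix := JointRange.convexHull_closure_numRange A hdim
  refine ⟨⟨hcl, hmix⟩, fun h ℓ hℓ => ?_, fun h => ?_⟩
  · have := JointRange.numRange_add_dilate_subset A hdim hℓ.le
    rwa [h.closure_eq] at this
  · refine isClosed_of_closure_subset ?_
    rw [hcl, hmix]
    refine convexHull_min ?_ (convex_convexHull ℝ _)
    simp only [JointRange.mixedRange, Set.iUnion_subset_iff]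
    intro ℓ hℓ
    -- The term `ℓ = k` is `numRange k A` itself, because the dilate by `0` is `{0}`.
    rcases (Set.mem_Iic.1 hℓ).lt_or_eq with h' | rfl
    · exact h ℓ h'
    · simpa [JointRange.dilate] using subset_convexHull ℝ (JointRange.numRange ℓ A)
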